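/- Let $n\ge 0$ and let $\mathbb C\langle s_{ij} : 1\le i<j\le n\rangle$ be the free unital associative algebra on the swap variables $s_{ij}$, with the convention $s_{ji}=s_{ij}$. Let $\mathcal I^{\mathrm{swap}}$ be its two-sided ideal generated by the elements $s_{ij}^2-1$ for all distinct $i,j$, and $$s_{ij}s_{jk}-s_{ik}s_{ij},\qquad s_{ij}s_{jk}+s_{jk}s_{ij}-(s_{ij}+s_{jk}+s_{ik}-1)$$ for all pairwise distinct $i,j,k\in\{1,\dots,n\}$. The vertex support of a monomial (a word in the $s_{ij}$) is the set of all indices that occur in it. Theorem. Every polynomial $p\in\mathbb C\langle s_{ij}\rangle$ is equal modulo $\mathcal I^{\mathrm{swap}}$ to some polynomial $q$ with $\deg q\le\lceil n/2\rceil$. Moreover, $q$ can be taken such that every monomial $m$ occurring in $q$ with nonzero coefficient is a product $m=m_1m_2\cdots m_r$ ($r\ge 0$) of monomials, all of degree one except possibly one of degree two, where for all $a\ne b$ the monomials $m_a$ and $m_b$ have disjoint vertex supports and commute modulo $\mathcal I^{\mathrm{swap}}$. -/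

import Mathlib

namespace SwapAlgebra

/-- The edges of the complete graph on `n` vertices: unordered pairs of distinct vertices.
They index the swap variables, so that `s_{ij}` and `s_{ji}` are the same variable. -/
abbrev Edge (n : ℕ) : Type := {e : Sym2 (Fin n) // ¬ e.IsDiag}

/-- Noncommutative polynomials in the `n`-vertex swap variables: the free algebra
`ℂ⟨s_{ij} | 1 ≤ i < j ≤ n⟩`. -/
abbrev SwapPoly (n : ℕ) : Type := FreeAlgebra ℂ (Edge n)

/-- Monomials (words, possibly empty) in the `n`-vertex swap variables. -/
abbrev SwapMonomial (n : ℕ) : Type := FreeMonoid (Edge n)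

/-- The swap variable `s_{ij} = s_{ji}`. -/
def swapVar {n : ℕ} (i j : Fin n) (h : i ≠ j) : SwapPoly n :=
  FreeAlgebra.ι ℂ ⟨s(i, j), fun hd => h (Sym2.mk_isDiag_iff.mp hd)⟩

/-- The defining relators of the symbolic swap algebra. -/
def swapRelators (n : ℕ) : Set (SwapPoly n) :=
  {f | ∃ (i j : Fin n) (hij : i ≠ j), f = swapVar i j hij ^ 2 - 1} ∪
  {f | ∃ (i j k : Fin n) (hij : i ≠ j) (hjk : j ≠ k) (hik : i ≠ k),
    f = swapVar i j hij * swapVar j k hjk - swapVar i k hik * swapVar i j hij} ∪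
  {f | ∃ (i j k : Fin n) (hij : i ≠ j) (hjk : j ≠ k) (hik : i ≠ k),
    f = (swapVar i j hij * swapVar j k hjk + swapVar j k hjk * swapVar i j hij)
      - (swapVar i j hij + swapVar j k hjk + swapVar i k hik - 1)}

/-- The two-sided ideal `I^swap` of the free algebra. -/
def swapIdeal (n : ℕ) : TwoSidedIdeal (SwapPoly n) :=
  TwoSidedIdeal.span (swapRelators n)

/-- Equality of polynomials modulo `I^swap`. -/
def EqModSwap {n : ℕ} (p q : SwapPoly n) : Prop := p - q ∈ swapIdeal n

/-- A monomial, viewed as a polynomial. -/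
def monomialPoly {n : ℕ} (m : SwapMonomial n) : SwapPoly n :=
  FreeMonoid.lift (FreeAlgebra.ι ℂ) m

/-- The monomials that occur in `p` with a nonzero coefficient. -/
noncomputable def terms {n : ℕ} (p : SwapPoly n) : Finset (SwapMonomial n) :=
  (FreeAlgebra.equivMonoidAlgebraFreeMonoid p).coeff.support

/-- The degree of a polynomial: the largest length of a monomial occurring in it
(`0` for the zero polynomial). -/
noncomputable def degree {n : ℕ} (p : SwapPoly n) : ℕ :=
  (terms p).sup FreeMonoid.length

/-- The vertices of the support graph of a monomial: the indices that appear in it. -/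
def vertexSupport {n : ℕ} (m : SwapMonomial n) : Set (Fin n) :=
  {v | ∃ e ∈ FreeMonoid.toList m, v ∈ e.1}

/-- The monomial `w` is a product `m₁ m₂ ⋯ m_r` (`r ≥ 0`) of monomials, all of degree one except
possibly one of degree two, that commute pairwise modulo `I^swap` and have pairwise
vertex-disjoint support graphs. -/
def IsDisjointProduct {n : ℕ} (w : SwapMonomial n) : Prop :=
  ∃ ms : List (SwapMonomial n),
    w = ms.prod ∧
    (∀ m ∈ ms, m.length = 1 ∨ m.length = 2) ∧
    ms.countP (fun m => m.length = 2) ≤ 1 ∧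
    ms.Pairwise (fun a b =>
      EqModSwap (monomialPoly a * monomialPoly b) (monomialPoly b * monomialPoly a)) ∧
    ms.Pairwise (fun a b => Disjoint (vertexSupport a) (vertexSupport b))

end SwapAlgebra

namespace SwapAlgebra

/-! In the quotient, a product of swaps along a path behaves like a cycle: it depends only on the
cyclic order of its vertices (`rotate_three`, `rotate_four`, `rotate_six`). By the anticommutator
relation, exchanging the first two vertices flips its sign modulo products with fewer swaps
(`path_add_path`). On 4 or 6 vertices these two facts combine: fixing one vertex and rotating the
other 3 or 5 gives a sign -1 of odd order, so twice the path is a sum of shorter products.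

Hence matchings, together with at most one two-edge path disjoint from the matching, span
everything. It suffices that this span, `normalSpan`, contains 1 and is stable under left
multiplication by a swap. Such a swap cancels an edge, adds one, or joins components; `four_mem`,
`five_mem`, `three_three_mem` and `three_four_mem` reduce the results that are not yet normal.

The degree bound counts vertices: a matching with r edges uses 2r vertices, and adding a two-edge
path costs 3 vertices for 2 degrees. -/

/-- The vertex `a` differs from all vertices of the list. -/
def AllNe {V : Type*} (a : V) : List V → Prop
  | [] => True
  | b :: l => a ≠ b ∧ AllNe a l

/-- The vertices of the list are pairwise distinct. -/
def Distinct {V : Type*} : List V → Prop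
  | [] => True
  | a :: l => AllNe a l ∧ Distinct l

/-- The vertices of the list lie outside of `X`. -/
def Avoids {V : Type*} (X : Finset V) : List V → Prop
  | [] => True
  | a :: l => a ∉ X ∧ Avoids X l

section

variable {V : Type*} {a b : V} {l : List V} {X : Finset V}

@[grind =] theorem allNe_nil : AllNe a [] ↔ True := Iff.rfl

@[grind =] theorem allNe_cons : AllNe a (b :: l) ↔ a ≠ b ∧ AllNe a l := Iff.rfl

@[grind =] theorem distinct_nil : Distinct ([] : List V) ↔ True := Iff.rfl

@[grind =] theorem distinct_cons : Distinct (a :: l) ↔ AllNe a l ∧ Distinct l := Iff.rfl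

@[grind =] theorem avoids_nil : Avoids X [] ↔ True := Iff.rfl

@[grind =] theorem avoids_cons : Avoids X (a :: l) ↔ a ∉ X ∧ Avoids X l := Iff.rfl

end

/-- A family of elements of an algebra that satisfies the relations of the swap algebra. -/
structure IsSwapFamily {V A : Type*} [Ring A] (s : V → V → A) : Prop where
  symm : ∀ i j, s i j = s j i
  sq : ∀ {i j}, i ≠ j → s i j * s i j = 1
  conj : ∀ {i j k}, i ≠ j → j ≠ k → i ≠ k → s i j * s j k = s i k * s i j
  anti : ∀ {i j k}, i ≠ j → j ≠ k → i ≠ k →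
    s i j * s j k + s j k * s i j = s i j + s j k + s i k - 1

/-- Products of swaps along the edges of a matching with vertex set `X`. -/
inductive IsMatchingProduct {V A : Type*} [DecidableEq V] [Ring A] (s : V → V → A) :
    Finset V → A → Prop
  | one : IsMatchingProduct s ∅ 1
  | cons {X : Finset V} {m : A} {a b : V} (hab : a ≠ b) (ha : a ∉ X) (hb : b ∉ X)
      (hm : IsMatchingProduct s X m) : IsMatchingProduct s (insert a (insert b X)) (s a b * m)

/-- The span of the matching products and of the products of a path with two edges and a matching
that avoids it. -/
def normalSpan {V A : Type*} [DecidableEq V] [Ring A] [Algebra ℂ A] (s : V → V → A) :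
    Submodule ℂ A :=
  Submodule.span ℂ ({x | ∃ X, IsMatchingProduct s X x} ∪
    {x | ∃ X m a b c, IsMatchingProduct s X m ∧ Distinct [a, b, c] ∧ Avoids X [a, b, c] ∧
      x = s a b * (s b c * m)})

/-! ### Rotation, commutation and sign relations for paths. -/

namespace IsSwapFamily

variable {V A : Type*} [Ring A] {s : V → V → A}

theorem sq_mul (hs : IsSwapFamily s) {i j : V} (h : i ≠ j) (x : A) :
    s i j * (s i j * x) = x := by
  rw [← mul_assoc, hs.sq h, one_mul]

theorem conj_mul (hs : IsSwapFamily s) {i j k : V} (hij : i ≠ j) (hjk : j ≠ k) (hik : i ≠ k)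
    (x : A) : s i j * (s j k * x) = s i k * (s i j * x) := by
  rw [← mul_assoc, hs.conj hij hjk hik, mul_assoc]

theorem rotate_three (hs : IsSwapFamily s) {a b c : V} (h : Distinct [a, b, c]) (x : A) :
    s a b * (s b c * x) = s c a * (s a b * x) := by
  rw [hs.conj_mul (by grind) (by grind) (by grind), hs.symm a c]

theorem rotate_four (hs : IsSwapFamily s) {a b c d : V} (h : Distinct [a, b, c, d]) (x : A) :
    s a b * (s b c * (s c d * x)) = s d a * (s a b * (s b c * x)) := by
  rw [hs.rotate_three (a := b) (b := c) (c := d) (by grind), hs.symm d b,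
    hs.rotate_three (a := a) (b := b) (c := d) (by grind)]

theorem rotate_six (hs : IsSwapFamily s) {a b c d e f : V} (h : Distinct [a, b, c, d, e, f])
    (x : A) :
    s a b * (s b c * (s c d * (s d e * (s e f * x)))) =
      s f a * (s a b * (s b c * (s c d * (s d e * x)))) := by
  rw [hs.rotate_four (a := c) (b := d) (c := e) (d := f) (by grind), hs.symm f c,
    hs.rotate_four (a := a) (b := b) (c := c) (d := f) (by grind)]

/-- Conjugation by `s i j` exchanges the indices i and j, and `s k l` is both `s k i * s i l * s k
i` and `s k j * s j l * s k j`; the conjugation carries the first form to the second. -/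
theorem commute (hs : IsSwapFamily s) {i j k l : V} (h : Distinct [i, j, k, l]) :
    s i j * s k l = s k l * s i j := by
  have e : s k l = s k i * (s i l * s k i) := by
    rw [← mul_assoc, hs.conj (i := k) (j := i) (k := l) (by grind) (by grind) (by grind),
      mul_assoc, hs.sq (by grind), mul_one]
  have e' : s k l = s k j * (s j l * s k j) := by
    rw [← mul_assoc, hs.conj (i := k) (j := j) (k := l) (by grind) (by grind) (by grind),
      mul_assoc, hs.sq (by grind), mul_one]
  have h1 : ∀ x, s i j * (s k i * x) = s k j * (s i j * x) := fun x => by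
    rw [hs.symm i j, hs.symm k i, hs.conj_mul (by grind) (by grind) (by grind), hs.symm j k]
  have h2 : ∀ x, s i j * (s i l * x) = s j l * (s i j * x) := fun x => by
    rw [hs.symm i j, hs.conj_mul (by grind) (by grind) (by grind)]
  have h3 : s i j * s k i = s k j * s i j := by simpa using h1 1
  nth_rewrite 1 [e]
  rw [h1, h2, h3, e', mul_assoc, mul_assoc]

theorem commute_mul (hs : IsSwapFamily s) {i j k l : V} (h : Distinct [i, j, k, l]) (x : A) :
    s i j * (s k l * x) = s k l * (s i j * x) := by
  rw [← mul_assoc, hs.commute h, mul_assoc]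

/-- The anticommutator relation, with its second product rewritten as a path from b through a to c.
-/
theorem path_add_path (hs : IsSwapFamily s) {a b c : V} (h : Distinct [a, b, c]) (x : A) :
    s a b * (s b c * x) + s b a * (s a c * x) = s a b * x + s b c * x + s a c * x - x := by
  have h1 : s b a * s a c = s b c * s a b := by
    rw [hs.conj (by grind) (by grind) (by grind), hs.symm b a]
  have := hs.anti (i := a) (j := b) (k := c) (by grind) (by grind) (by grind)
  rw [← mul_assoc, ← mul_assoc, h1, ← add_mul, this]
  noncomm_ring

/-- Disjoint edges commute, so the edge at a chosen vertex can be moved to the front. -/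
theorem exists_eq_mul [DecidableEq V] {X : Finset V} {m : A} (hs : IsSwapFamily s)
    (hm : IsMatchingProduct s X m) {a : V} (ha : a ∈ X) :
    ∃ b X' m', a ≠ b ∧ a ∉ X' ∧ b ∉ X' ∧ X = insert a (insert b X') ∧
      IsMatchingProduct s X' m' ∧ m = s a b * m' := by
  induction hm with
  | one => simp at ha
  | @cons X m c d hcd hc hd hm ih =>
    by_cases hac : a = c
    · subst hac
      exact ⟨d, X, m, hcd, hc, hd, rfl, hm, rfl⟩
    by_cases had : a = d
    · subst had
      exact ⟨c, X, m, hcd.symm, hd, hc, Finset.insert_comm _ _ _, hm, by rw [hs.symm]⟩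
    obtain ⟨b, X', m', hab, ha', hb', rfl, hm', rfl⟩ := ih (by simpa [hac, had] using ha)
    refine ⟨b, insert c (insert d X'), s c d * m', hab, by grind, by grind, by grind,
      .cons hcd (by grind) (by grind) hm', hs.commute_mul (by grind) _⟩

/-! ### Reduction of longer paths and of pairs of paths. -/

variable [Algebra ℂ A]

/-- The linear map f allows the reduction to be used inside a longer product, with factors on either
side. -/
theorem path_four_mem (hs : IsSwapFamily s) (W : Submodule ℂ A) (f : A →ₗ[ℂ] A)
    {a b c d : V} (h : Distinct [a, b, c, d])
    (h₁ : f (s a b * s c d) ∈ W ∧ f (s b c * s c d) ∈ W ∧ f (s a c * s c d) ∈ W ∧ f (s c d) ∈ W)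
    (h₂ : f (s a c * s d b) ∈ W ∧ f (s c d * s d b) ∈ W ∧ f (s a d * s d b) ∈ W ∧ f (s d b) ∈ W)
    (h₃ : f (s a d * s b c) ∈ W ∧ f (s d b * s b c) ∈ W ∧ f (s a b * s b c) ∈ W ∧ f (s b c) ∈ W) :
    f (s a b * (s b c * s c d)) ∈ W := by
  have key : ∀ {b c d : V}, Distinct [a, b, c, d] →
      (f (s a b * s c d) ∈ W ∧ f (s b c * s c d) ∈ W ∧ f (s a c * s c d) ∈ W ∧ f (s c d) ∈ W) →
      f (s a b * (s b c * s c d)) + f (s a c * (s c d * s d b)) ∈ W := by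
    intro b c d h ⟨h1, h2, h3, h4⟩
    have e := hs.rotate_four (a := a) (b := c) (c := d) (d := b) (by grind) 1
    simp only [mul_one] at e
    rw [e, ← map_add, hs.path_add_path (by grind), map_sub, map_add, map_add]
    exact sub_mem (add_mem (add_mem h1 h2) h3) h4
  have k1 := key h h₁
  have k2 := key (b := c) (c := d) (d := b) (by grind) h₂
  have k3 := key (b := d) (c := b) (d := c) (by grind) h₃
  -- With P₁, P₂, P₃ the paths for the three rotations of (b, c, d), (P₁ + P₂) + (P₃ + P₁) - (P₂ +
  -- P₃) = 2 P₁.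
  have := W.smul_mem (1 / 2 : ℂ) (sub_mem (add_mem k1 k3) k2)
  convert this using 1
  module

variable [DecidableEq V] {X : Finset V} {m : A}

theorem matching_mem (hm : IsMatchingProduct s X m) : m ∈ normalSpan s :=
  Submodule.subset_span (.inl ⟨X, hm⟩)

theorem edge_mem (hm : IsMatchingProduct s X m) {a b : V} (h : Distinct [a, b])
    (hX : Avoids X [a, b]) : s a b * m ∈ normalSpan s :=
  matching_mem (.cons (by grind) (by grind) (by grind) hm)

theorem edge_edge_mem (hm : IsMatchingProduct s X m) {a b c d : V} (h : Distinct [a, b, c, d])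
    (hX : Avoids X [a, b, c, d]) : s a b * (s c d * m) ∈ normalSpan s :=
  edge_mem (.cons (a := c) (b := d) (by grind) (by grind) (by grind) hm) (by grind) (by grind)

theorem three_mem (hm : IsMatchingProduct s X m) {a b c : V} (h : Distinct [a, b, c])
    (hX : Avoids X [a, b, c]) : s a b * (s b c * m) ∈ normalSpan s :=
  Submodule.subset_span (.inr ⟨X, m, a, b, c, hm, h, hX, rfl⟩)

theorem edge_three_mem (hs : IsSwapFamily s) (hm : IsMatchingProduct s X m) {a b c d e : V}
    (h : Distinct [a, b, c, d, e]) (hX : Avoids X [a, b, c, d, e]) :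
    s a b * (s c d * (s d e * m)) ∈ normalSpan s := by
  rw [hs.commute_mul (by grind), hs.commute_mul (i := a) (by grind)]
  exact three_mem (.cons (a := a) (b := b) (by grind) (by grind) (by grind) hm) (by grind)
    (by grind)

theorem three_edge_mem (hm : IsMatchingProduct s X m) {a b c d e : V}
    (h : Distinct [a, b, c, d, e]) (hX : Avoids X [a, b, c, d, e]) :
    s a b * (s b c * (s d e * m)) ∈ normalSpan s :=
  three_mem (.cons (a := d) (b := e) (by grind) (by grind) (by grind) hm) (by grind) (by grind)

theorem four_mem (hs : IsSwapFamily s) (hm : IsMatchingProduct s X m) {a b c d : V}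
    (h : Distinct [a, b, c, d]) (hX : Avoids X [a, b, c, d]) :
    s a b * (s b c * (s c d * m)) ∈ normalSpan s := by
  have := hs.path_four_mem (normalSpan s) (LinearMap.mulRight ℂ m) h
  simp only [LinearMap.mulRight_apply, mul_assoc] at this
  apply this <;> refine ⟨edge_edge_mem hm ?_ ?_, three_mem hm ?_ ?_, three_mem hm ?_ ?_,
    edge_mem hm ?_ ?_⟩ <;> grind

theorem five_mem (hs : IsSwapFamily s) (hm : IsMatchingProduct s X m) {a b c d e : V}
    (h : Distinct [a, b, c, d, e]) (hX : Avoids X [a, b, c, d, e]) :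
    s a b * (s b c * (s c d * (s d e * m))) ∈ normalSpan s := by
  have := hs.path_four_mem (a := a) (b := b) (c := c) (d := d) (normalSpan s)
    (LinearMap.mulRight ℂ (s d e * m)) (by grind)
  simp only [LinearMap.mulRight_apply, mul_assoc] at this
  apply this
  · exact ⟨hs.edge_three_mem hm (by grind) (by grind), hs.four_mem hm (by grind) (by grind),
      hs.four_mem hm (by grind) (by grind), three_mem hm (by grind) (by grind)⟩
  · rw [hs.rotate_three (a := c) (b := d) (c := b) (by grind),
      hs.rotate_three (a := a) (b := d) (c := b) (by grind), hs.symm d b]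
    exact ⟨hs.edge_three_mem hm (by grind) (by grind), hs.four_mem hm (by grind) (by grind),
      hs.four_mem hm (by grind) (by grind), three_mem hm (by grind) (by grind)⟩
  · rw [← hs.rotate_three (a := b) (b := c) (c := d) (by grind)]
    refine ⟨?_, hs.four_mem hm (by grind) (by grind),
      three_edge_mem hm (by grind) (by grind), edge_edge_mem hm (by grind) (by grind)⟩
    rw [hs.commute_mul (i := b) (j := c) (k := d) (l := e) (by grind)]
    exact three_edge_mem hm (by grind) (by grind)

theorem six_mem (hs : IsSwapFamily s) (hm : IsMatchingProduct s X m) {a b c d e f : V}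
    (h : Distinct [a, b, c, d, e, f]) (hX : Avoids X [a, b, c, d, e, f]) :
    s a b * (s b c * (s c d * (s d e * (s e f * m)))) ∈ normalSpan s := by
  have key : ∀ {b c d e f : V}, Distinct [a, b, c, d, e, f] → Avoids X [a, b, c, d, e, f] →
      s a b * (s b c * (s c d * (s d e * (s e f * m)))) +
        s a c * (s c d * (s d e * (s e f * (s f b * m)))) ∈ normalSpan s := by
    intro b c d e f h hX
    rw [hs.rotate_six (a := a) (b := c) (c := d) (d := e) (e := f) (f := b) (by grind),
      hs.path_add_path (by grind)]
    refine sub_mem (add_mem (add_mem ?_ (hs.five_mem hm (by grind) (by grind)))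
      (hs.five_mem hm (by grind) (by grind))) (hs.four_mem hm (by grind) (by grind))
    rw [hs.commute_mul (by grind), hs.commute_mul (i := a) (by grind),
      hs.commute_mul (i := a) (by grind)]
    exact hs.four_mem (.cons (a := a) (b := b) (by grind) (by grind) (by grind) hm) (by grind)
      (by grind)
  have k1 := key h hX
  have k2 := key (b := c) (c := d) (d := e) (e := f) (f := b) (by grind) (by grind)
  have k3 := key (b := d) (c := e) (d := f) (e := b) (f := c) (by grind) (by grind)
  have k4 := key (b := e) (c := f) (d := b) (e := c) (f := d) (by grind) (by grind)
  have k5 := key (b := f) (c := b) (d := c) (e := d) (f := e) (by grind) (by grind)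
  -- The alternating sum over the five rotations telescopes to twice the first path, since five is
  -- odd.
  have := (normalSpan s).smul_mem (1 / 2 : ℂ)
    (add_mem (sub_mem k1 k2) (add_mem (sub_mem k3 k4) k5))
  convert this using 1
  module

/-- Multiplying the relation on b, c, d by `s a b * s b c` turns its term -x into minus the product
of the two paths. The other terms are six-vertex paths or have fewer swaps, so `six_mem` and the
shorter cases suffice. -/
theorem three_three_mem (hs : IsSwapFamily s) (hm : IsMatchingProduct s X m) {a b c d e f : V}
    (h : Distinct [a, b, c, d, e, f]) (hX : Avoids X [a, b, c, d, e, f]) :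
    s a b * (s b c * (s d e * (s e f * m))) ∈ normalSpan s := by
  have key := congrArg (fun z => s a b * (s b c * z))
    (hs.path_add_path (a := b) (b := c) (c := d) (by grind) (s d e * (s e f * m)))
  simp only [mul_add, mul_sub, hs.symm c b] at key
  rw [hs.sq_mul (i := b) (j := c) (by grind), hs.sq_mul (i := b) (j := c) (by grind),
    hs.sq_mul (i := b) (j := c) (by grind)] at key
  have h1 : s a b * (s c d * (s d e * (s e f * m))) ∈ normalSpan s := by
    rw [hs.commute_mul (by grind), hs.commute_mul (i := a) (by grind),
      hs.commute_mul (i := a) (by grind)]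
    exact hs.four_mem (.cons (a := a) (b := b) (by grind) (by grind) (by grind) hm) (by grind)
      (by grind)
  have h2 : s a b * (s b d * (s d e * (s e f * m))) ∈ normalSpan s :=
    hs.five_mem hm (by grind) (by grind)
  have h3 : s a b * (s d e * (s e f * m)) ∈ normalSpan s :=
    hs.edge_three_mem hm (by grind) (by grind)
  have h4 : s a b * (s b c * (s c d * (s d e * (s e f * m)))) ∈ normalSpan s :=
    hs.six_mem hm (by grind) (by grind)
  have h5 : s a b * (s b c * (s b d * (s d e * (s e f * m)))) ∈ normalSpan s := by
    rw [hs.rotate_three (a := a) (b := b) (c := c) (by grind)]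
    exact hs.six_mem hm (by grind) (by grind)
  have := add_mem (sub_mem (sub_mem h3 (add_mem h1 h2)) (neg_mem h4)) h5
  convert this using 1
  rw [eq_sub_iff_add_eq] at key
  rw [← sub_eq_zero, ← sub_eq_zero.mpr key]
  abel

theorem three_four_mem (hs : IsSwapFamily s) (hm : IsMatchingProduct s X m) {a b c d e f g : V}
    (h : Distinct [a, b, c, d, e, f, g]) (hX : Avoids X [a, b, c, d, e, f, g]) :
    s a b * (s b c * (s d e * (s e f * (s f g * m)))) ∈ normalSpan s := by
  have := hs.path_four_mem (a := d) (b := e) (c := f) (d := g) (normalSpan s)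
    (LinearMap.mulLeft ℂ (s a b * s b c) ∘ₗ LinearMap.mulRight ℂ m) (by grind)
  simp only [LinearMap.comp_apply, LinearMap.mulLeft_apply, LinearMap.mulRight_apply,
    mul_assoc] at this
  apply this <;> refine ⟨three_edge_mem (.cons ?_ ?_ ?_ hm) ?_ ?_, hs.three_three_mem hm ?_ ?_,
    hs.three_three_mem hm ?_ ?_, three_edge_mem hm ?_ ?_⟩ <;> grind (gen := 20) (ematch := 20)

/-! ### Stability of the normal span under left multiplication by a swap. -/

theorem swap_mul_matching_mem (hs : IsSwapFamily s) (hm : IsMatchingProduct s X m) {i j : V}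
    (hij : i ≠ j) : s i j * m ∈ normalSpan s := by
  by_cases hi : i ∈ X
  · obtain ⟨k, X', m', hik, hi', hk', rfl, hm', rfl⟩ := hs.exists_eq_mul hm hi
    by_cases hk : j = k
    · subst hk
      rw [hs.sq_mul hij]
      exact matching_mem hm'
    rw [hs.symm i j]
    by_cases hj : j ∈ X'
    · obtain ⟨l, X'', m'', hjl, hj'', hl'', rfl, hm'', rfl⟩ := hs.exists_eq_mul hm' hj
      -- The swap joins two matching edges; rotation displays them as the path k, i, j, l.
      rw [← hs.rotate_three (by grind)]
      exact hs.four_mem hm'' (by grind) (by grind)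
    · exact three_mem hm' (by grind) (by grind)
  by_cases hj : j ∈ X
  · obtain ⟨k, X', m', hjk, hj', hk', rfl, hm', rfl⟩ := hs.exists_eq_mul hm hj
    exact three_mem hm' (by grind) (by grind)
  · exact edge_mem hm (by grind) (by grind)

/-- The swap misses the path and acts on the matching alone, leaving beside the path an edge, a
two-edge path, a three-edge path, or nothing new. -/
theorem three_swap_mem (hs : IsSwapFamily s) (hm : IsMatchingProduct s X m) {a b c i j : V}
    (h : Distinct [a, b, c, i, j]) (hX : Avoids X [a, b, c]) :
    s a b * (s b c * (s i j * m)) ∈ normalSpan s := by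
  by_cases hi : i ∈ X
  · obtain ⟨k, X', m', hik, hi', hk', rfl, hm', rfl⟩ := hs.exists_eq_mul hm hi
    by_cases hk : j = k
    · subst hk
      rw [hs.sq_mul hik]
      exact three_mem hm' (by grind) (by grind)
    rw [hs.symm i j]
    by_cases hj : j ∈ X'
    · obtain ⟨l, X'', m'', hjl, hj'', hl'', rfl, hm'', rfl⟩ := hs.exists_eq_mul hm' hj
      rw [← hs.rotate_three (c := j) (by grind)]
      exact hs.three_four_mem hm'' (by grind) (by grind)
    · exact hs.three_three_mem hm' (by grind (gen := 20) (ematch := 20))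
        (by grind (gen := 20) (ematch := 20))
  by_cases hj : j ∈ X
  · obtain ⟨k, X', m', hjk, hj', hk', rfl, hm', rfl⟩ := hs.exists_eq_mul hm hj
    exact hs.three_three_mem hm' (by grind (gen := 20) (ematch := 20))
        (by grind (gen := 20) (ematch := 20))
  · exact three_edge_mem hm (by grind) (by grind)

theorem swap_mul_three_mem_of_eq (hs : IsSwapFamily s) (hm : IsMatchingProduct s X m) {a b c j : V}
    (h : Distinct [a, b, c]) (hX : Avoids X [a, b, c]) (haj : a ≠ j) :
    s a j * (s a b * (s b c * m)) ∈ normalSpan s := by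
  by_cases hb : j = b
  · subst hb
    rw [hs.sq_mul haj]
    exact edge_mem hm (by grind) (by grind)
  by_cases hc : j = c
  · subst hc
    rw [hs.rotate_three h, hs.symm j a, hs.sq_mul haj]
    exact edge_mem hm (by grind) (by grind)
  rw [hs.symm a j]
  by_cases hj : j ∈ X
  · obtain ⟨l, X', m', hjl, hj', hl', rfl, hm', rfl⟩ := hs.exists_eq_mul hm hj
    -- Rotation moves j to the end, where its matching edge prolongs the path to a, b, c, j, l.
    rw [← hs.rotate_four (by grind)]
    exact hs.five_mem hm' (by grind (gen := 20) (ematch := 20))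
        (by grind (gen := 20) (ematch := 20))
  · exact hs.four_mem hm (by grind) (by grind)

/-- If the swap meets the path, rotation makes the common vertex the first one; otherwise it
commutes past the path. -/
theorem swap_mul_three_mem (hs : IsSwapFamily s) (hm : IsMatchingProduct s X m) {a b c i j : V}
    (h : Distinct [a, b, c]) (hX : Avoids X [a, b, c]) (hij : i ≠ j) :
    s i j * (s a b * (s b c * m)) ∈ normalSpan s := by
  have key : ∀ {i j : V}, i ≠ j → i ∈ [a, b, c] →
      s i j * (s a b * (s b c * m)) ∈ normalSpan s := by
    intro i j hij hi
    simp only [List.mem_cons, List.not_mem_nil, or_false] at hi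
    rcases hi with rfl | rfl | rfl
    · exact hs.swap_mul_three_mem_of_eq hm h hX hij
    · rw [hs.rotate_three h, hs.rotate_three (by grind)]
      exact hs.swap_mul_three_mem_of_eq hm (by grind) (by grind) hij
    · rw [hs.rotate_three h]
      exact hs.swap_mul_three_mem_of_eq hm (by grind) (by grind) hij
  by_cases hi : i ∈ [a, b, c]
  · exact key hij hi
  by_cases hj : j ∈ [a, b, c]
  · rw [hs.symm i j]
    exact key hij.symm hj
  rw [hs.commute_mul (by grind), hs.commute_mul (i := i) (by grind)]
  exact hs.three_swap_mem hm (by grind) hX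

theorem swap_mul_mem (hs : IsSwapFamily s) {i j : V} (hij : i ≠ j) {x : A}
    (hx : x ∈ normalSpan s) : s i j * x ∈ normalSpan s := by
  induction hx using Submodule.span_induction with
  | mem x hx =>
    rcases hx with ⟨X, hm⟩ | ⟨X, m, a, b, c, hm, h, hX, rfl⟩
    · exact hs.swap_mul_matching_mem hm hij
    · exact hs.swap_mul_three_mem hm h hX hij
  | zero => simp
  | add x y _ _ hx hy => rw [mul_add]; exact add_mem hx hy
  | smul r x _ hx => rw [mul_smul_comm]; exact Submodule.smul_mem _ _ hx

end IsSwapFamily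


/-! ### The quotient as a swap family, and commuting monomials. -/

variable {n : ℕ}

/-- The symbolic swap algebra. -/
abbrev SwapQuotient (n : ℕ) : Type := (swapIdeal n).ringCon.Quotient

/-- The quotient map onto the symbolic swap algebra. -/
def toQuotient (n : ℕ) : SwapPoly n →ₐ[ℂ] SwapQuotient n := (swapIdeal n).ringCon.mkₐ ℂ

theorem eqModSwap_iff {p q : SwapPoly n} : EqModSwap p q ↔ toQuotient n p = toQuotient n q := by
  rw [EqModSwap, ← TwoSidedIdeal.rel_iff]
  exact (RingCon.eq _).symm

theorem toQuotient_eq_of_mem {p q : SwapPoly n} (h : p - q ∈ swapRelators n) :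
    toQuotient n p = toQuotient n q :=
  eqModSwap_iff.mp (TwoSidedIdeal.subset_span h)

/-- The swap of `i` and `j` in the swap algebra, with the value `1` for `i = j`. -/
def swap (i j : Fin n) : SwapQuotient n :=
  if h : i ≠ j then toQuotient n (swapVar i j h) else 1

theorem swap_of_ne {i j : Fin n} (h : i ≠ j) : swap i j = toQuotient n (swapVar i j h) :=
  dif_pos h

theorem isSwapFamily_swap : IsSwapFamily (swap (n := n)) where
  symm i j := by
    by_cases h : i = j
    · rw [h]
    · rw [swap_of_ne h, swap_of_ne (Ne.symm h)]
      simp only [swapVar, Sym2.eq_swap]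
  sq {i j} h := by
    rw [swap_of_ne h, ← map_mul, ← map_one (toQuotient n), ← pow_two]
    exact toQuotient_eq_of_mem (.inl (.inl ⟨i, j, h, rfl⟩))
  conj {i j k} hij hjk hik := by
    rw [swap_of_ne hij, swap_of_ne hjk, swap_of_ne hik, ← map_mul, ← map_mul]
    exact toQuotient_eq_of_mem (.inl (.inr ⟨i, j, k, hij, hjk, hik, rfl⟩))
  anti {i j k} hij hjk hik := by
    rw [swap_of_ne hij, swap_of_ne hjk, swap_of_ne hik, ← map_one (toQuotient n)]
    simp only [← map_mul, ← map_add, ← map_sub]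
    exact toQuotient_eq_of_mem (.inr ⟨i, j, k, hij, hjk, hik, rfl⟩)

theorem exists_ι_eq (e : Edge n) : ∃ i j, i ≠ j ∧ (∀ v, v ∈ e.1 ↔ v = i ∨ v = j) ∧
    toQuotient n (FreeAlgebra.ι ℂ e) = swap i j := by
  obtain ⟨e, he⟩ := e
  induction e using Sym2.ind with
  | _ i j =>
    have h : i ≠ j := fun h => he (Sym2.mk_isDiag_iff.mpr h)
    exact ⟨i, j, h, fun v => Sym2.mem_iff, by rw [swap_of_ne h]; rfl⟩

theorem exists_edge {i j : Fin n} (h : i ≠ j) : ∃ e : Edge n, (∀ v, v ∈ e.1 ↔ v = i ∨ v = j) ∧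
    toQuotient n (FreeAlgebra.ι ℂ e) = swap i j :=
  ⟨⟨s(i, j), fun hd => h (Sym2.mk_isDiag_iff.mp hd)⟩, fun _ => Sym2.mem_iff,
    by rw [swap_of_ne h]; rfl⟩

theorem monomialPoly_mul (a b : SwapMonomial n) :
    monomialPoly (a * b) = monomialPoly a * monomialPoly b :=
  map_mul _ a b

theorem monomialPoly_of (e : Edge n) : monomialPoly (.of e) = FreeAlgebra.ι ℂ e :=
  FreeMonoid.lift_eval_of _ e

theorem vertexSupport_mul (a b : SwapMonomial n) :
    vertexSupport (a * b) = vertexSupport a ∪ vertexSupport b := by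
  ext v
  simp only [vertexSupport, FreeMonoid.toList_mul, List.mem_append, Set.mem_ofPred_eq,
    Set.mem_union]
  grind

theorem mem_vertexSupport_of {e : Edge n} {v : Fin n} : v ∈ vertexSupport (.of e) ↔ v ∈ e.1 := by
  simp [vertexSupport]

theorem commute_ι {e f : Edge n} (h : ∀ v ∈ e.1, v ∉ f.1) :
    Commute (toQuotient n (FreeAlgebra.ι ℂ e)) (toQuotient n (FreeAlgebra.ι ℂ f)) := by
  obtain ⟨i, j, hij, he, he'⟩ := exists_ι_eq e
  obtain ⟨k, l, hkl, hf, hf'⟩ := exists_ι_eq f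
  rw [he', hf']
  have hi := h i
  have hj := h j
  exact isSwapFamily_swap.commute (by grind)

theorem eqModSwap_mul_comm {a b : SwapMonomial n}
    (h : Disjoint (vertexSupport a) (vertexSupport b)) :
    EqModSwap (monomialPoly a * monomialPoly b) (monomialPoly b * monomialPoly a) := by
  rw [eqModSwap_iff, map_mul, map_mul]
  change Commute _ _
  induction a using FreeMonoid.inductionOn' with
  | one => simp [monomialPoly]
  | of_mul e a ih =>
    rw [vertexSupport_mul, Set.disjoint_union_left] at h
    rw [monomialPoly_mul, map_mul, monomialPoly_of]
    obtain ⟨h, h'⟩ := h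
    refine Commute.mul_left ?_ (ih h')
    clear ih h'
    induction b using FreeMonoid.inductionOn' with
    | one => simp [monomialPoly]
    | of_mul f b ih =>
      rw [vertexSupport_mul, Set.disjoint_union_right] at h
      rw [monomialPoly_mul, map_mul, monomialPoly_of]
      refine Commute.mul_right (commute_ι fun v hv hv' => ?_) (ih h.2)
      exact Set.disjoint_left.mp h.1 (mem_vertexSupport_of.mpr hv) (mem_vertexSupport_of.mpr hv')

/-! ### Normal words and their degrees. -/

/-- The disjoint products of degree at most `⌈n/2⌉`. -/
def normalWords (n : ℕ) : Set (SwapMonomial n) :=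
  {w | IsDisjointProduct w ∧ w.length ≤ ⌈(n : ℚ) / 2⌉₊}

/-- The slack of 1 in the doubled bound is used up when a two-edge path and a matching cover all n
vertices, with n odd. -/
theorem mem_normalWords {ms : List (SwapMonomial n)} (h : ∀ m ∈ ms, m.length = 1 ∨ m.length = 2)
    (hc : ms.countP (fun m => m.length = 2) ≤ 1)
    (hd : ms.Pairwise (fun a b => Disjoint (vertexSupport a) (vertexSupport b)))
    (hl : 2 * ms.prod.length ≤ n + 1) : ms.prod ∈ normalWords n := by
  refine ⟨⟨ms, rfl, h, hc, hd.imp eqModSwap_mul_comm, hd⟩, ?_⟩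
  have h1 : (n : ℚ) / 2 ≤ (⌈(n : ℚ) / 2⌉₊ : ℚ) := Nat.le_ceil _
  have h2 : (n : ℚ) ≤ ((2 * ⌈(n : ℚ) / 2⌉₊ : ℕ) : ℚ) := by push_cast; linarith
  have h3 := Nat.cast_le.mp h2
  omega

theorem exists_list_of_isMatchingProduct {X : Finset (Fin n)} {m : SwapQuotient n}
    (hm : IsMatchingProduct swap X m) :
    ∃ ms : List (SwapMonomial n), (∀ w ∈ ms, w.length = 1 ∧ vertexSupport w ⊆ X) ∧
      ms.Pairwise (fun a b => Disjoint (vertexSupport a) (vertexSupport b)) ∧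
      2 * ms.prod.length = X.card ∧ toQuotient n (monomialPoly ms.prod) = m := by
  induction hm with
  | one => exact ⟨[], by simp, by simp, by simp, by simp [monomialPoly]⟩
  | @cons X m a b hab ha hb hm ih =>
    obtain ⟨ms, h1, h2, h3, rfl⟩ := ih
    obtain ⟨e, he, he'⟩ := exists_edge hab
    refine ⟨.of e :: ms, ?_, ?_, ?_, ?_⟩
    · intro w hw
      rcases List.mem_cons.mp hw with rfl | hw
      · refine ⟨FreeMonoid.length_of _, fun v hv => ?_⟩
        rw [mem_vertexSupport_of, he] at hv
        simpa [or_assoc] using Or.inl hv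
      · refine ⟨(h1 w hw).1, (h1 w hw).2.trans ?_⟩
        intro v hv
        simp_all
    · refine List.pairwise_cons.mpr ⟨fun w hw => Set.disjoint_left.mpr fun v hv hv' => ?_, h2⟩
      have := (h1 w hw).2 hv'
      rw [mem_vertexSupport_of, he] at hv
      grind
    · rw [List.prod_cons, FreeMonoid.length_mul, FreeMonoid.length_of, mul_add, h3,
        Finset.card_insert_of_notMem (by grind), Finset.card_insert_of_notMem hb]
      omega
    · rw [List.prod_cons, monomialPoly_mul, map_mul, monomialPoly_of, he']

theorem exists_normalWord {x : SwapQuotient n}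
    (hx : x ∈ {x | ∃ X, IsMatchingProduct swap X x} ∪
      {x | ∃ X m a b c, IsMatchingProduct swap X m ∧ Distinct [a, b, c] ∧ Avoids X [a, b, c] ∧
        x = swap a b * (swap b c * m)}) :
    ∃ w ∈ normalWords n, toQuotient n (monomialPoly w) = x := by
  rcases hx with ⟨X, hm⟩ | ⟨X, m, a, b, c, hm, h, hX, rfl⟩
  · obtain ⟨ms, h1, h2, h3, rfl⟩ := exists_list_of_isMatchingProduct hm
    refine ⟨ms.prod, mem_normalWords (fun w hw => .inl (h1 w hw).1) ?_ h2 ?_, rfl⟩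
    · rw [List.countP_eq_zero.mpr fun w hw => by simp [(h1 w hw).1]]
      exact zero_le_one
    · have := card_finset_fin_le X
      omega
  · obtain ⟨ms, h1, h2, h3, rfl⟩ := exists_list_of_isMatchingProduct hm
    obtain ⟨e, he, he'⟩ := exists_edge (i := a) (j := b) (by grind)
    obtain ⟨f, hf, hf'⟩ := exists_edge (i := b) (j := c) (by grind)
    have hl : (FreeMonoid.of e * FreeMonoid.of f : SwapMonomial n).length = 2 := by
      simp [FreeMonoid.length_mul]
    refine ⟨((FreeMonoid.of e * FreeMonoid.of f) :: ms).prod, mem_normalWords ?_ ?_ ?_ ?_, ?_⟩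
    · intro w hw
      rcases List.mem_cons.mp hw with rfl | hw
      · exact .inr hl
      · exact .inl (h1 w hw).1
    · rw [List.countP_cons, List.countP_eq_zero.mpr fun w hw => by simp [(h1 w hw).1]]
      simp [hl]
    · refine List.pairwise_cons.mpr ⟨fun w hw => Set.disjoint_left.mpr fun v hv hv' => ?_, h2⟩
      have := (h1 w hw).2 hv'
      rw [vertexSupport_mul, Set.mem_union, mem_vertexSupport_of, mem_vertexSupport_of, he,
        hf] at hv
      grind
    -- The path and matching occupy 3 + |X| ≤ n vertices, and twice the degree is 4 + |X|.
    · have := card_finset_fin_le (insert a (insert b (insert c X)))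
      rw [Finset.card_insert_of_notMem (by grind), Finset.card_insert_of_notMem (by grind),
        Finset.card_insert_of_notMem (by grind)] at this
      rw [List.prod_cons, FreeMonoid.length_mul, hl]
      omega
    · rw [List.prod_cons, monomialPoly_mul, monomialPoly_mul, map_mul, map_mul, monomialPoly_of,
        monomialPoly_of, he', hf', mul_assoc]

/-! ### Spanning of the quotient, and lifting to the free algebra. -/

theorem toQuotient_mul_mem (p : SwapPoly n) {x : SwapQuotient n} (hx : x ∈ normalSpan swap) :
    toQuotient n p * x ∈ normalSpan swap := by
  induction p using FreeAlgebra.induction generalizing x with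
  | grade0 r =>
    rw [AlgHom.commutes, ← Algebra.smul_def]
    exact Submodule.smul_mem _ _ hx
  | grade1 e =>
    obtain ⟨i, j, hij, -, h⟩ := exists_ι_eq e
    rw [h]
    exact isSwapFamily_swap.swap_mul_mem hij hx
  | mul p q hp hq =>
    rw [map_mul, mul_assoc]
    exact hp (hq hx)
  | add p q hp hq =>
    rw [map_add, add_mul]
    exact add_mem (hp hx) (hq hx)

theorem exists_mem_span_normalWords (p : SwapPoly n) :
    ∃ q ∈ Submodule.span ℂ (monomialPoly '' normalWords n), EqModSwap p q := by
  -- The unit is the empty matching product, so stability puts p · 1 in the span.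
  have h : toQuotient n p ∈ normalSpan swap := by
    simpa using toQuotient_mul_mem p (IsSwapFamily.matching_mem .one)
  have hle : normalSpan swap ≤
      (Submodule.span ℂ (monomialPoly '' normalWords n)).map (toQuotient n).toLinearMap := by
    refine Submodule.span_le.mpr fun x hx => ?_
    obtain ⟨w, hw, rfl⟩ := exists_normalWord hx
    exact ⟨monomialPoly w, Submodule.subset_span ⟨w, hw, rfl⟩, rfl⟩
  obtain ⟨q, hq, hqp⟩ := hle h
  exact ⟨q, hq, eqModSwap_iff.mpr hqp.symm⟩

theorem equivMonoidAlgebraFreeMonoid_monomialPoly (w : SwapMonomial n) :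
    FreeAlgebra.equivMonoidAlgebraFreeMonoid (monomialPoly w) = MonoidAlgebra.of ℂ _ w := by
  induction w using FreeMonoid.inductionOn' with
  | one => simp [monomialPoly, MonoidAlgebra.one_def]
  | of_mul e w ih =>
    rw [monomialPoly_mul, map_mul, ih, monomialPoly_of, map_mul]
    simp [FreeAlgebra.equivMonoidAlgebraFreeMonoid]

theorem terms_subset_of_mem_span {S : Set (SwapMonomial n)} {q : SwapPoly n}
    (hq : q ∈ Submodule.span ℂ (monomialPoly '' S)) : ∀ w ∈ terms q, w ∈ S := by
  induction hq using Submodule.span_induction with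
  | mem x hx =>
    obtain ⟨v, hv, rfl⟩ := hx
    intro w hw
    rw [terms, equivMonoidAlgebraFreeMonoid_monomialPoly, MonoidAlgebra.of_apply,
      MonoidAlgebra.coeff_single] at hw
    rwa [Finset.mem_singleton.mp (Finsupp.support_single_subset hw)]
  | zero => simp [terms]
  | add x y _ _ hx hy =>
    intro w hw
    classical
    rw [terms, map_add, MonoidAlgebra.coeff_add] at hw
    rcases Finset.mem_union.mp (Finsupp.support_add hw) with h | h
    · exact hx w h
    · exact hy w h
  | smul r x _ hx =>
    intro w hw
    rw [terms, map_smul, MonoidAlgebra.coeff_smul] at hw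
    exact hx w (Finsupp.support_smul hw)

end SwapAlgebra

theorem mainTheorem2 (n : ℕ) (p : SwapAlgebra.SwapPoly n) :
    ∃ q : SwapAlgebra.SwapPoly n,
      SwapAlgebra.EqModSwap p q ∧
      SwapAlgebra.degree q ≤ ⌈(n : ℚ) / 2⌉₊ ∧
      ∀ w ∈ SwapAlgebra.terms q, SwapAlgebra.IsDisjointProduct w := by
  obtain ⟨q, hq, hpq⟩ := SwapAlgebra.exists_mem_span_normalWords p
  have h := SwapAlgebra.terms_subset_of_mem_span hq
  exact ⟨q, hpq, Finset.sup_le fun w hw => (h w hw).2, fun w hw => (h w hw).1⟩
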